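/- Let $R$ be a commutative ring with identity. A semidualizing $R$-module is an $R$-module $C$ such that $C$ has a projective resolution by finitely generated projective modules, the homothety map $R\to \mathrm{Hom}_R(C,C)$ is an isomorphism, and $\mathrm{Ext}^i_R(C,C)=0$ for all $i\ge 1$. Fix such a $C$. Let $\mathcal P(R)$ be the class of projective $R$-modules, let $\mathcal P_C(R)$ be the class of modules isomorphic to $C\otimes_R P$ with $P$ projective, and let $\mathcal F_C(R)$ be the class of modules isomorphic to $C\otimes_R F$ with $F$ flat. For a class $\mathcal X$ of modules, let $\widetilde{\mathcal X}$ be the class of exact ($\mathbb Z$-indexed, unbounded) complexes of $R$-modules all of whose cycle modules lie in $\mathcal X$; complexes in $\widetilde{\mathcal F_C(R)}$ are called $C$-flat. A sequence $L$ in an abelian category is $\mathrm{Hom}(-,\mathcal B)$-exact if the sequence $\mathrm{Hom}(L,B)$ of abelian groups is exact for every $B\in\mathcal B$. A module $M$ is $D_C$-projective if there is an exact, $\mathrm{Hom}(-,\mathcal F_C(R))$-exact sequence of modules $$\cdots\to P_1\to P_0\xrightarrow{f_0} Q_{-1}\to Q_{-2}\to\cdots$$ with all $P_i\in\mathcal P(R)$,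 all $Q_i\in\mathcal P_C(R)$ and $M\cong\mathrm{Im} f_0$. A complex $X$ is $D_C$-projective if there is an exact, $\mathrm{Hom}(-,\widetilde{\mathcal F_C(R)})$-exact sequence of complexes of the same shape with all $P_i\in\widetilde{\mathcal P(R)}$, all $Q_i\in\widetilde{\mathcal P_C(R)}$ and $X\cong\mathrm{Im} f_0$; here $\mathrm{Hom}$ is the group of morphisms of complexes. For complexes $X,Y$, let $\mathcal{H}om(X,Y)$ be the complex of abelian groups whose elements of degree $n$ are the families of $R$-linear maps $X^t\to Y^{n+t}$, $t\in\mathbb Z$, with differential $f\mapsto \delta_Y f-(-1)^n f\delta_X$. **Theorem.** Let $X$ be a complex of $R$-modules. Then $X$ is a $D_C$-projective complex if and only if $X^i$ is a $D_C$-projective module for every $i\in\mathbb Z$ and $\mathcal{H}om(X,H)$ is exact for every $C$-flat complex $H$. -/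

import Mathlib

open CategoryTheory CategoryTheory.Limits

universe u v w

section AbelianCategory

variable {A : Type v} [Category.{w} A] [Abelian A]

/-- A sequence `L` of objects of an abelian category is `Hom(-, ℬ)`-exact if the sequence of abelian
groups `⋯ ⟶ Hom(Lᵏ, B) ⟶ Hom(Lʲ, B) ⟶ Hom(Lⁱ, B) ⟶ ⋯` is exact at every spot,
for every object `B` of `ℬ`. -/
def IsHomExact (L : CochainComplex A ℤ) (ℬ : ObjectProperty A) : Prop :=
  ∀ B : A, ℬ B → ∀ i j k : ℤ, i + 1 = j → j + 1 = k →
    Function.Exact (fun g : L.X k ⟶ B => L.d j k ≫ g) (fun g : L.X j ⟶ B => L.d i j ≫ g)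

/-- `M` is the image of `P₀ ⟶ Q₋₁` in some exact and `Hom(-, ℬ)`-exact sequence
`⋯ ⟶ P₁ ⟶ P₀ ⟶ Q₋₁ ⟶ Q₋₂ ⟶ ⋯` with all `Pᵢ` in `𝒰` and all `Qᵢ` in `𝒱`. The sequence is indexed
in the direction of its maps: `P₀` sits in degree `0`, `P₁` in degree `-1`, and `Q₋₁` in
degree `1`. -/
def IsImageInCompleteResolution (𝒰 𝒱 ℬ : ObjectProperty A) (M : A) : Prop :=
  ∃ L : CochainComplex A ℤ,
    L.Acyclic ∧ IsHomExact L ℬ ∧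
    (∀ n : ℤ, n ≤ 0 → 𝒰 (L.X n)) ∧ (∀ n : ℤ, 0 < n → 𝒱 (L.X n)) ∧
    Nonempty (M ≅ image (L.d 0 1))

/-- The class of `𝒳`-complexes: the exact complexes all of whose cycles lie in `𝒳`. -/
def complexesWithCyclesIn (𝒳 : ObjectProperty A) : ObjectProperty (CochainComplex A ℤ) :=
  fun X => X.Acyclic ∧ ∀ i : ℤ, 𝒳 (X.cycles i)

end AbelianCategory

section Modules

variable {R : Type u} [CommRing R]

/-- Semidualizing modules over a commutative ring. -/
structure IsSemidualizing (C : ModuleCat.{u} R) : Prop where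
  /-- `C` has a degreewise finite projective resolution. -/
  exists_resolution : ∃ P : ProjectiveResolution C, ∀ n : ℕ, Module.Finite R (P.complex.X n)
  /-- The homothety map `R → Hom(C, C)` is an isomorphism. -/
  homothety_bijective : Function.Bijective (LinearMap.lsmul R C : R →ₗ[R] C →ₗ[R] C)
  /-- `Extⁱ(C, C) = 0` for all `i ≥ 1`. -/
  ext_eq_zero : ∀ i : ℕ, 1 ≤ i → Subsingleton (Abelian.Ext.{u} C C i)

variable (R) in
/-- The class of projective modules. -/
def projectiveModules : ObjectProperty (ModuleCat.{u} R) :=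
  fun M => Module.Projective R M

/-- The class of `C`-projective modules: those isomorphic to `C ⊗ P` with `P` projective. -/
def cProjectiveModules (C : ModuleCat.{u} R) : ObjectProperty (ModuleCat.{u} R) :=
  fun M => ∃ P : ModuleCat.{u} R, Module.Projective R P ∧ Nonempty (M ≃ₗ[R] TensorProduct R C P)

/-- The class of `C`-flat modules: those isomorphic to `C ⊗ F` with `F` flat. -/
def cFlatModules (C : ModuleCat.{u} R) : ObjectProperty (ModuleCat.{u} R) :=
  fun M => ∃ F : ModuleCat.{u} R, Module.Flat R F ∧ Nonempty (M ≃ₗ[R] TensorProduct R C F)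

/-- `D_C`-projective modules. -/
def IsDCProjectiveModule (C M : ModuleCat.{u} R) : Prop :=
  IsImageInCompleteResolution (projectiveModules R) (cProjectiveModules C) (cFlatModules C) M

variable (R) in
/-- Projective complexes: exact complexes with projective cycles. -/
def projectiveComplexes : ObjectProperty (CochainComplex (ModuleCat.{u} R) ℤ) :=
  complexesWithCyclesIn (projectiveModules R)

/-- `C`-projective complexes: exact complexes with `C`-projective cycles. -/
def cProjectiveComplexes (C : ModuleCat.{u} R) :
    ObjectProperty (CochainComplex (ModuleCat.{u} R) ℤ) :=
  complexesWithCyclesIn (cProjectiveModules C)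

/-- `C`-flat complexes: exact complexes with `C`-flat cycles. -/
def cFlatComplexes (C : ModuleCat.{u} R) :
    ObjectProperty (CochainComplex (ModuleCat.{u} R) ℤ) :=
  complexesWithCyclesIn (cFlatModules C)

/-- `D_C`-projective complexes; the exact sequence is one in the abelian category of complexes. -/
def IsDCProjectiveComplex (C : ModuleCat.{u} R) (X : CochainComplex (ModuleCat.{u} R) ℤ) : Prop :=
  IsImageInCompleteResolution (projectiveComplexes R) (cProjectiveComplexes C) (cFlatComplexes C) X

end Modules

-- An exact `Hom(-, ℬ)`-exact sequence is the same as short exact sequences spliced together, with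
-- every map to an object of `ℬ` extending along their monomorphisms. Both directions are proved
-- with these pieces.
--
-- From complexes to modules, evaluate the resolution of `X` in one degree. Testing against disk
-- complexes shows that extension properties survive (`ExtendsAlong.eval`). For exactness of `Hom(X,
-- H)`, use `0 ⟶ K ⟶ P₀ ⟶ X ⟶ 0`: `P₀` is contractible, and cocycles `K ⟶ H` of degree `n` are
-- morphisms to the `C`-flat complex `H⟦n⟧`, so they extend to `P₀`.
--
-- Conversely, `X` is resolved one step at a time in both directions by disk complexes. On the left
-- these are built from projective covers of the terms (`exists_projective_step`), on the right from
-- the first `C`-projective modules in coresolutions of the terms (`exists_cProjective_step`). The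
-- disk complexes are contractible, so exactness of `Hom(-, H)` passes to kernels and cokernels. It
-- also corrects termwise extensions to chain maps. On the right the new cokernel has terms `Nⁿ ×
-- Qⁿ⁺¹` up to isomorphism (`coresolved.of_prod`), so the construction repeats.
--
-- The homological input is `Extⁱ(C ⊗ P, C ⊗ F) = 0` for `i ≥ 1`
-- (`IsSemidualizing.extOrthogonal_of_cProjective`), obtained from `Extⁱ(C, C) = 0` by tensor
-- evaluation on the finitely presented syzygies of `C`.

universe w'

/-! ### Short exact sequences and splicing. -/

section ShortExactPairs

variable {A : Type v} [Category.{w} A] [Abelian A]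

/-- The sequence `0 ⟶ X ⟶ Y ⟶ Z ⟶ 0` given by `i` and `p` is exact. -/
def IsShortExact {X Y Z : A} (i : X ⟶ Y) (p : Y ⟶ Z) : Prop :=
  ∃ w : i ≫ p = 0, (ShortComplex.mk i p w).ShortExact

/-- Every morphism from the source of `i` to an object of `ℬ` extends along `i`. -/
def ExtendsAlong (ℬ : ObjectProperty A) {X Y : A} (i : X ⟶ Y) : Prop :=
  ∀ B : A, ℬ B → ∀ f : X ⟶ B, ∃ g : Y ⟶ B, i ≫ g = f

namespace IsShortExact

variable {X Y Z : A} {i : X ⟶ Y} {p : Y ⟶ Z}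

lemma zero (h : IsShortExact i p) : i ≫ p = 0 := h.1

lemma mono (h : IsShortExact i p) : Mono i := h.2.mono_f

lemma epi (h : IsShortExact i p) : Epi p := h.2.epi_g

lemma exists_desc (h : IsShortExact i p) {B : A} (f : Y ⟶ B) (hf : i ≫ f = 0) :
    ∃ g : Z ⟶ B, p ≫ g = f := by
  obtain ⟨w, h⟩ := h
  have := h.epi_g
  exact ⟨h.exact.desc f hf, h.exact.g_desc f hf⟩

lemma exists_lift (h : IsShortExact i p) {B : A} (f : B ⟶ Y) (hf : f ≫ p = 0) :
    ∃ g : B ⟶ X, g ≫ i = f := by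
  obtain ⟨w, h⟩ := h
  have := h.mono_f
  exact ⟨h.exact.lift f hf, h.exact.lift_f f hf⟩

lemma of_iso_left (h : IsShortExact i p) {X' : A} (e : X' ≅ X) : IsShortExact (e.hom ≫ i) p := by
  obtain ⟨w, h⟩ := h
  refine ⟨by simp [w], ShortComplex.shortExact_of_iso ?_ h⟩
  exact ShortComplex.isoMk e.symm (Iso.refl _) (Iso.refl _)

lemma of_iso_right (h : IsShortExact i p) {Z' : A} (e : Z ≅ Z') :
    IsShortExact i (p ≫ e.hom) := by
  obtain ⟨w, h⟩ := h
  refine ⟨by simp [reassoc_of% w], ShortComplex.shortExact_of_iso ?_ h⟩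
  exact ShortComplex.isoMk (Iso.refl _) (Iso.refl _) e

lemma kernel_ι (p : Y ⟶ Z) [Epi p] : IsShortExact (kernel.ι p) p :=
  ⟨kernel.condition p, ⟨ShortComplex.exact_of_f_is_kernel _ (kernelIsKernel p)⟩⟩

lemma cokernel_π (i : X ⟶ Y) [Mono i] : IsShortExact i (cokernel.π i) :=
  ⟨cokernel.condition i, ⟨ShortComplex.exact_of_g_is_cokernel _ (cokernelIsCokernel i)⟩⟩

/-- The third terms of two short exact sequences with the same monomorphism are isomorphic. -/
lemma nonempty_iso_right {Z' : A} {p' : Y ⟶ Z'} (h : IsShortExact i p) (h' : IsShortExact i p') :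
    Nonempty (Z ≅ Z') := by
  obtain ⟨a, ha⟩ := h.exists_desc p' h'.zero
  obtain ⟨b, hb⟩ := h'.exists_desc p h.zero
  have := h.epi
  have := h'.epi
  exact ⟨⟨a, b, by rw [← cancel_epi p, reassoc_of% ha, hb, Category.comp_id],
    by rw [← cancel_epi p', reassoc_of% hb, ha, Category.comp_id]⟩⟩

end IsShortExact

/-- The short exact sequences `0 ⟶ Zⁿ ⟶ Xⁿ ⟶ Zⁿ⁺¹ ⟶ 0` of an exact complex. -/
lemma isShortExact_cycles {X : CochainComplex A ℤ} (hX : X.Acyclic) (m n : ℤ) (h : m + 1 = n) :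
    IsShortExact (X.iCycles m) (X.toCycles m n) := by
  refine ⟨by simp [← cancel_mono (X.iCycles n)], ?_⟩
  have hepi : Epi (X.toCycles m n) := by
    obtain rfl : m = (ComplexShape.up ℤ).prev n := by simp [← h]
    exact (hX n).epi_toCycles
  refine { exact := ?_ }
  have hex : (ShortComplex.mk (X.iCycles m) (X.d m n) (by simp)).Exact :=
    ShortComplex.exact_of_f_is_kernel _ (X.cyclesIsKernel m n (by simp [h]))
  exact (ShortComplex.exact_iff_of_epi_of_isIso_of_mono
    (S₁ := ShortComplex.mk (X.iCycles m) (X.toCycles m n) (by simp [← cancel_mono (X.iCycles n)]))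
    (S₂ := ShortComplex.mk (X.iCycles m) (X.d m n) (by simp))
    { τ₁ := 𝟙 _, τ₂ := 𝟙 _, τ₃ := X.iCycles n }).2 hex

/-- The complex `X` is spliced together from short exact sequences
`0 ⟶ Kⁿ ⟶ Xⁿ ⟶ Kⁿ⁺¹ ⟶ 0`. -/
structure SplicedBy (X : CochainComplex A ℤ) (K : ℤ → A) where
  /-- The monomorphisms `Kⁿ ⟶ Xⁿ`. -/
  ι : ∀ n, K n ⟶ X.X n
  /-- The epimorphisms `Xⁿ ⟶ Kⁿ⁺¹`. -/
  π : ∀ m n, m + 1 = n → (X.X m ⟶ K n)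
  isShortExact : ∀ m n h, IsShortExact (ι m) (π m n h)
  d_eq : ∀ m n h, X.d m n = π m n h ≫ ι n

/-- An exact complex is spliced together from its cycles. -/
noncomputable def SplicedBy.cycles {X : CochainComplex A ℤ} (hX : X.Acyclic) :
    SplicedBy X (fun n => X.cycles n) where
  ι n := X.iCycles n
  π m n _ := X.toCycles m n
  isShortExact m n h := isShortExact_cycles hX m n h
  d_eq m n _ := (X.toCycles_i m n).symm

/-- The complex spliced together from short exact sequences. -/
def spliceComplex {K L : ℤ → A} (ι : ∀ n, K n ⟶ L n) (π : ∀ m n, m + 1 = n → (L m ⟶ K n))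
    (hs : ∀ m n h, IsShortExact (ι m) (π m n h)) : CochainComplex A ℤ where
  X := L
  d m n := if h : m + 1 = n then π m n h ≫ ι n else 0
  shape _ _ h := dif_neg h
  d_comp_d' i j k hij hjk := by
    have hij : i + 1 = j := hij
    have hjk : j + 1 = k := hjk
    simp [hij, hjk, reassoc_of% (hs j k hjk).zero]

/-- `spliceComplex` is spliced together from the given short exact sequences. -/
def splicedBySpliceComplex {K L : ℤ → A} (ι : ∀ n, K n ⟶ L n)
    (π : ∀ m n, m + 1 = n → (L m ⟶ K n)) (hs : ∀ m n h, IsShortExact (ι m) (π m n h)) :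
    SplicedBy (spliceComplex ι π hs) K where
  ι := ι
  π := π
  isShortExact := hs
  d_eq _ _ h := dif_pos h

namespace SplicedBy

variable {X : CochainComplex A ℤ} {K : ℤ → A} (s : SplicedBy X K)

include s

lemma acyclic : X.Acyclic := by
  intro j
  rw [X.exactAt_iff' (j - 1) j (j + 1) (by simp) (by simp)]
  have hij : (j - 1) + 1 = j := by lia
  have hepi := (s.isShortExact (j - 1) j hij).epi
  have hmono := (s.isShortExact (j + 1) (j + 1 + 1) rfl).mono
  have hz := (s.isShortExact j _ rfl).zero
  -- Exactness is unchanged by precomposing the first map with an epimorphism (`φ`) or composing the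
  -- second with a monomorphism (`ψ`).
  let S₁ := ShortComplex.mk (s.ι j) (s.π j (j + 1) rfl) hz
  let S₂ := ShortComplex.mk (X.d (j - 1) j) (s.π j (j + 1) rfl)
    (by rw [s.d_eq _ _ hij, Category.assoc, hz, comp_zero])
  let φ : S₂ ⟶ S₁ :=
    { τ₁ := s.π (j - 1) j hij, τ₂ := 𝟙 _, τ₃ := 𝟙 _
      comm₁₂ := by simp [S₁, S₂, s.d_eq _ _ hij]
      comm₂₃ := by simp [S₁, S₂] }
  let ψ : S₂ ⟶ X.sc' (j - 1) j (j + 1) :=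
    { τ₁ := 𝟙 _, τ₂ := 𝟙 _, τ₃ := s.ι (j + 1)
      comm₁₂ := (Category.id_comp _).trans (Category.comp_id _).symm
      comm₂₃ := (Category.id_comp _).trans (s.d_eq j _ rfl) }
  have : Epi φ.τ₁ := hepi
  have : IsIso φ.τ₂ := inferInstanceAs (IsIso (𝟙 _))
  have : Mono φ.τ₃ := inferInstanceAs (Mono (𝟙 _))
  have : Epi ψ.τ₁ := inferInstanceAs (Epi (𝟙 _))
  have : IsIso ψ.τ₂ := inferInstanceAs (IsIso (𝟙 _))
  have : Mono ψ.τ₃ := hmono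
  rw [← ShortComplex.exact_iff_of_epi_of_isIso_of_mono ψ,
    ShortComplex.exact_iff_of_epi_of_isIso_of_mono φ]
  exact (s.isShortExact j _ rfl).2.exact

lemma nonempty_cyclesIso (n : ℤ) : Nonempty (X.cycles n ≅ K n) := by
  have hs := s.isShortExact n (n + 1) rfl
  have := hs.mono
  have := (s.isShortExact (n + 1) (n + 1 + 1) rfl).mono
  obtain ⟨a, ha⟩ := hs.exists_lift (X.iCycles n) (by
    rw [← cancel_mono (s.ι (n + 1)), Category.assoc, ← s.d_eq, X.iCycles_d, zero_comp])
  let b := X.liftCycles (s.ι n) (n + 1) (by simp)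
    (by rw [s.d_eq n _ rfl, reassoc_of% hs.zero, zero_comp])
  exact ⟨⟨a, b, by rw [← cancel_mono (X.iCycles n)]; simp [b, ha],
    by rw [← cancel_mono (s.ι n)]; simp [b, ha]⟩⟩

end SplicedBy

section Splice

variable {𝒰 𝒱 ℬ : ObjectProperty A} {M : A}

lemma IsImageInCompleteResolution.exists_splicedBy
    (hM : IsImageInCompleteResolution 𝒰 𝒱 ℬ M) :
    ∃ (L : CochainComplex A ℤ) (K : ℤ → A) (s : SplicedBy L K), (∀ n, ExtendsAlong ℬ (s.ι n)) ∧
      (∀ n : ℤ, n ≤ 0 → 𝒰 (L.X n)) ∧ (∀ n : ℤ, 0 < n → 𝒱 (L.X n)) ∧ Nonempty (M ≅ K 1) := by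
  obtain ⟨L, hL, hB, hU, hV, ⟨e⟩⟩ := hM
  refine ⟨L, _, SplicedBy.cycles hL, ?_, hU, hV, ⟨e ≪≫ ?_⟩⟩
  · intro n B hBB f
    -- Pulled back to degree `n - 1`, `f` is killed by the incoming differential, so it factors
    -- through the outgoing one; cancelling the epimorphism onto the cycles gives the extension.
    obtain ⟨g, hg⟩ := (hB B hBB (n - 2) (n - 1) n (by lia) (by lia)
      (L.toCycles (n - 1) n ≫ f)).1 (by simp)
    have := (isShortExact_cycles hL (n - 1) n (by lia)).epi
    refine ⟨g, ?_⟩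
    rw [← cancel_epi (L.toCycles (n - 1) n), ← hg]
    exact L.toCycles_i_assoc _ _ _
  · have := (isShortExact_cycles hL 0 1 (by lia)).epi
    have := strongEpi_of_epi (L.toCycles 0 1)
    exact (image.isoStrongEpiMono (L.toCycles 0 1) (L.iCycles 1) (L.toCycles_i 0 1)).symm

lemma IsImageInCompleteResolution.of_splicedBy {X : CochainComplex A ℤ} {K : ℤ → A}
    (s : SplicedBy X K) (hB : ∀ n, ExtendsAlong ℬ (s.ι n))
    (hU : ∀ n : ℤ, n ≤ 0 → 𝒰 (X.X n)) (hV : ∀ n : ℤ, 0 < n → 𝒱 (X.X n)) (e : M ≅ K 1) :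
    IsImageInCompleteResolution 𝒰 𝒱 ℬ M := by
  refine ⟨X, s.acyclic, ?_, hU, hV, ⟨e ≪≫ ?_⟩⟩
  · intro B hBB i j k hij hjk f
    dsimp only
    constructor
    · intro hf
      have := (s.isShortExact i j hij).epi
      rw [s.d_eq i j hij, Category.assoc] at hf
      obtain ⟨g, hg⟩ := (s.isShortExact j k hjk).exists_desc f
        (by rw [← cancel_epi (s.π i j hij), hf, comp_zero])
      obtain ⟨g', hg'⟩ := hB k B hBB g
      exact ⟨g', by simp [s.d_eq j k hjk, hg', hg]⟩
    · rintro ⟨g, rfl⟩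
      simp
  · have := (s.isShortExact 0 1 rfl).epi
    have := (s.isShortExact 1 2 rfl).mono
    have := strongEpi_of_epi (s.π 0 1 rfl)
    exact image.isoStrongEpiMono (s.π 0 1 rfl) (s.ι 1) (s.d_eq 0 1 rfl).symm

/-- Splicing: an object from which one can build a resolution to the left, with terms in `𝒰` and
syzygies in `𝒯`, and one to the right, with terms in `𝒱` and cosyzygies in `𝒮`. -/
lemma IsImageInCompleteResolution.of_steps {𝒮 𝒯 : ObjectProperty A}
    (hT : ∀ N, 𝒯 N → ∃ (N' U : A) (i : N' ⟶ U) (p : U ⟶ N),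
      𝒯 N' ∧ 𝒰 U ∧ IsShortExact i p ∧ ExtendsAlong ℬ i)
    (hS : ∀ N, 𝒮 N → ∃ (V N' : A) (i : N ⟶ V) (p : V ⟶ N'),
      𝒱 V ∧ 𝒮 N' ∧ IsShortExact i p ∧ ExtendsAlong ℬ i)
    (hMS : 𝒮 M) (hMT : 𝒯 M) :
    IsImageInCompleteResolution 𝒰 𝒱 ℬ M := by
  choose! T U iT pT hT' hU hTs hTB using hT
  choose! V S iS pS hV hS' hSs hSB using hS
  let a : ℕ → A := fun n => S^[n] M
  let b : ℕ → A := fun n => T^[n] M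
  have ha : ∀ n, 𝒮 (a n) := by
    intro n
    induction n with
    | zero => exact hMS
    | succ n ih => simpa only [a, Function.iterate_succ_apply'] using hS' _ ih
  have hb : ∀ n, 𝒯 (b n) := by
    intro n
    induction n with
    | zero => exact hMT
    | succ n ih => simpa only [b, Function.iterate_succ_apply'] using hT' _ ih
  let K : ℤ → A := fun n => match n with
    | Int.ofNat n => a n
    | Int.negSucc n => b (n + 1)
  have key : ∀ n : ℤ, ∃ (W : A) (i : K n ⟶ W) (p : W ⟶ K (n + 1)),
      IsShortExact i p ∧ ExtendsAlong ℬ i ∧ (n < 0 → 𝒰 W) ∧ (0 ≤ n → 𝒱 W) := by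
    intro n
    match n with
    | Int.ofNat n =>
      have e : S (a n) = K (Int.ofNat n + 1) := (Function.iterate_succ_apply' S n M).symm
      exact ⟨V (a n), iS (a n), pS (a n) ≫ (eqToIso e).hom, (hSs _ (ha n)).of_iso_right _,
        hSB _ (ha n), fun h => absurd h (by simp), fun _ => hV _ (ha n)⟩
    | Int.negSucc n =>
      have e : K (Int.negSucc n) = T (b n) := Function.iterate_succ_apply' T n M
      have e' : b n = K (Int.negSucc n + 1) := by cases n <;> rfl
      refine ⟨U (b n), (eqToIso e).hom ≫ iT (b n), pT (b n) ≫ (eqToIso e').hom,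
        ((hTs _ (hb n)).of_iso_left _).of_iso_right _, ?_, fun _ => hU _ (hb n),
        fun h => absurd h (by simp)⟩
      intro B hB f
      obtain ⟨g, hg⟩ := hTB _ (hb n) B hB ((eqToIso e).inv ≫ f)
      exact ⟨g, by rw [Category.assoc, hg, Iso.hom_inv_id_assoc]⟩
  choose W i p hs hB hU' hV' using key
  -- `M` is `K 0` but must be the syzygy of index `1`, so everything is reindexed by one.
  have hK : ∀ m n : ℤ, m + 1 = n → K (m - 1 + 1) = K (n - 1) := by
    intro m n h
    congr 1
    lia
  exact IsImageInCompleteResolution.of_splicedBy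
    (splicedBySpliceComplex (K := fun n => K (n - 1)) (L := fun n => W (n - 1))
      (fun n => i (n - 1)) (fun m n h => p (m - 1) ≫ (eqToIso (hK m n h)).hom)
      (fun m n h => (hs (m - 1)).of_iso_right _))
    (fun n => hB (n - 1)) (fun n hn => hU' _ (by lia)) (fun n hn => hV' _ (by lia)) (Iso.refl _)

end Splice

end ShortExactPairs

/-! ### Exactness of Hom complexes. -/

section HomComplexes

open CochainComplex CochainComplex.HomComplex

variable {A : Type v} [Category.{w} A] [Abelian A]

lemma IsShortExact.eval {X Y Z : CochainComplex A ℤ} {i : X ⟶ Y} {p : Y ⟶ Z}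
    (h : IsShortExact i p) (n : ℤ) : IsShortExact (i.f n) (p.f n) :=
  ⟨by rw [← HomologicalComplex.comp_f, h.zero, HomologicalComplex.zero_f],
    h.2.map_of_exact (HomologicalComplex.eval A _ n)⟩

lemma homComplex_acyclic_iff {X H : CochainComplex A ℤ} :
    (HomComplex X H).Acyclic ↔ ∀ m n : ℤ, m + 1 = n → ∀ z : Cochain X H n,
      δ n (n + 1) z = 0 → ∃ w : Cochain X H m, δ m n w = z := by
  constructor
  · intro h m n hmn z hz
    have := (HomComplex X H).exactAt_iff' m n (n + 1) (by simp [← hmn]) (by simp) |>.1 (h n)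
    rw [ShortComplex.ab_exact_iff] at this
    exact this z hz
  · intro h n
    rw [(HomComplex X H).exactAt_iff' (n - 1) n (n + 1) (by simp) (by simp),
      ShortComplex.ab_exact_iff]
    exact fun z hz => h (n - 1) n (by lia) z hz

namespace CochainComplex.HomComplex.Cochain

variable {X₁ X₂ X₃ H : CochainComplex A ℤ} {i : X₁ ⟶ X₂} {p : X₂ ⟶ X₃}

lemma exists_extension (hH : ∀ (a b : ℤ) (f : X₁.X a ⟶ H.X b), ∃ g : X₂.X a ⟶ H.X b, i.f a ≫ g = f)
    {n : ℤ} (z : Cochain X₁ H n) :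
    ∃ y : Cochain X₂ H n, (Cochain.ofHom i).comp y (zero_add n) = z := by
  choose g hg using hH
  exact ⟨Cochain.mk fun a b hab => g a b (z.v a b hab), by ext a b hab; simp [hg]⟩

lemma exists_desc (h : IsShortExact i p) {n : ℤ} (y : Cochain X₂ H n)
    (hy : (Cochain.ofHom i).comp y (zero_add n) = 0) :
    ∃ x : Cochain X₃ H n, (Cochain.ofHom p).comp x (zero_add n) = y := by
  have : ∀ a b (hab : a + n = b), ∃ g, p.f a ≫ g = y.v a b hab := fun a b hab =>
    (h.eval a).exists_desc _ (by simpa using Cochain.congr_v hy a b hab)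
  choose g hg using this
  exact ⟨Cochain.mk fun a b hab => g a b hab, by ext a b hab; simp [hg]⟩

lemma ofHom_comp_injective (h : IsShortExact i p) {n : ℤ} {x y : Cochain X₃ H n}
    (hxy : (Cochain.ofHom p).comp x (zero_add n) = (Cochain.ofHom p).comp y (zero_add n)) :
    x = y := by
  ext a b hab
  have := (h.eval a).epi
  rw [← cancel_epi (p.f a)]
  simpa using Cochain.congr_v hxy a b hab

lemma ofHom_comp_ofHom_comp (h : IsShortExact i p) {n : ℤ} (x : Cochain X₃ H n) :
    (Cochain.ofHom i).comp ((Cochain.ofHom p).comp x (zero_add n)) (zero_add n) = 0 := by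
  ext a b hab
  simp [reassoc_of% (h.eval a).zero]

end CochainComplex.HomComplex.Cochain

section TwoOfThree

variable {X₁ X₂ X₃ H : CochainComplex A ℤ} {i : X₁ ⟶ X₂} {p : X₂ ⟶ X₃}

/-- Cocycles extend along a degreewise `Hom(-, H)`-exact monomorphism if `Hom(-, H)` of the cokernel
is exact. -/
lemma exists_cocycle_extension (h : IsShortExact i p)
    (hH : ∀ (a b : ℤ) (f : X₁.X a ⟶ H.X b), ∃ g : X₂.X a ⟶ H.X b, i.f a ≫ g = f)
    (h₃ : (HomComplex X₃ H).Acyclic) {n : ℤ} (z : Cochain X₁ H n) (hz : δ n (n + 1) z = 0) :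
    ∃ y : Cochain X₂ H n, δ n (n + 1) y = 0 ∧ (Cochain.ofHom i).comp y (zero_add n) = z := by
  obtain ⟨y, rfl⟩ := Cochain.exists_extension hH z
  rw [δ_ofHom_comp] at hz
  -- The obstruction `δ y` vanishes on `X₁`, hence descends to a cocycle on `X₃`; it is a coboundary
  -- `δ w` there, and `y` is corrected by `w`.
  obtain ⟨x, hx⟩ := Cochain.exists_desc h _ hz
  have hx' : δ (n + 1) (n + 1 + 1) x = 0 := by
    apply Cochain.ofHom_comp_injective h
    rw [← δ_ofHom_comp, hx, δ_δ, Cochain.comp_zero]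
  obtain ⟨w, rfl⟩ := homComplex_acyclic_iff.1 h₃ n (n + 1) rfl x hx'
  refine ⟨y - (Cochain.ofHom p).comp w (zero_add n), ?_, ?_⟩
  · rw [δ_sub, δ_ofHom_comp, hx, sub_self]
  · rw [Cochain.comp_sub, Cochain.ofHom_comp_ofHom_comp h, sub_zero]

lemma exists_hom_extension (h : IsShortExact i p)
    (hH : ∀ (a b : ℤ) (f : X₁.X a ⟶ H.X b), ∃ g : X₂.X a ⟶ H.X b, i.f a ≫ g = f)
    (h₃ : (HomComplex X₃ H).Acyclic) (f : X₁ ⟶ H) : ∃ g : X₂ ⟶ H, i ≫ g = f := by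
  obtain ⟨y, hy, hf⟩ := exists_cocycle_extension h hH h₃ (Cochain.ofHom f) (by simp)
  refine ⟨Cocycle.homOf (Cocycle.mk y (0 + 1) rfl hy), ?_⟩
  ext n
  simpa using Cochain.congr_v hf n n (add_zero n)

lemma homComplex_acyclic_left (h : IsShortExact i p)
    (hH : ∀ (a b : ℤ) (f : X₁.X a ⟶ H.X b), ∃ g : X₂.X a ⟶ H.X b, i.f a ≫ g = f)
    (h₂ : (HomComplex X₂ H).Acyclic) (h₃ : (HomComplex X₃ H).Acyclic) :
    (HomComplex X₁ H).Acyclic := by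
  rw [homComplex_acyclic_iff]
  intro m n hmn z hz
  obtain ⟨y, hy, rfl⟩ := exists_cocycle_extension h hH h₃ z hz
  obtain ⟨w, rfl⟩ := homComplex_acyclic_iff.1 h₂ m n hmn y hy
  exact ⟨(Cochain.ofHom i).comp w (zero_add m), by rw [δ_ofHom_comp]⟩

/-- `Hom(X₃, H)` is exact if `Hom(X₂, H)` is and cocycles on `X₁` extend to `X₂`. -/
lemma homComplex_acyclic_right_of_extension (h : IsShortExact i p)
    (h₁ : ∀ (n : ℤ) (z : Cochain X₁ H n), δ n (n + 1) z = 0 →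
      ∃ y : Cochain X₂ H n, δ n (n + 1) y = 0 ∧ (Cochain.ofHom i).comp y (zero_add n) = z)
    (h₂ : (HomComplex X₂ H).Acyclic) : (HomComplex X₃ H).Acyclic := by
  rw [homComplex_acyclic_iff]
  rintro m n rfl z hz
  obtain ⟨w, hw⟩ := homComplex_acyclic_iff.1 h₂ m (m + 1) rfl
    ((Cochain.ofHom p).comp z (zero_add _)) (by rw [δ_ofHom_comp, hz, Cochain.comp_zero])
  obtain ⟨y, hy, hyw⟩ := h₁ m ((Cochain.ofHom i).comp w (zero_add m))
    (by rw [δ_ofHom_comp, hw, Cochain.ofHom_comp_ofHom_comp h])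
  obtain ⟨x, hx⟩ := Cochain.exists_desc h (w - y) (by rw [Cochain.comp_sub, hyw, sub_self])
  refine ⟨x, Cochain.ofHom_comp_injective h ?_⟩
  rw [← δ_ofHom_comp, hx, δ_sub, hy, sub_zero, hw]

lemma homComplex_acyclic_right (h : IsShortExact i p)
    (hH : ∀ (a b : ℤ) (f : X₁.X a ⟶ H.X b), ∃ g : X₂.X a ⟶ H.X b, i.f a ≫ g = f)
    (h₁ : (HomComplex X₁ H).Acyclic) (h₂ : (HomComplex X₂ H).Acyclic) :
    (HomComplex X₃ H).Acyclic := by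
  refine homComplex_acyclic_right_of_extension h (fun n z hz => ?_) h₂
  -- Cochains extend freely, so a coboundary `δ v` extends to a coboundary.
  obtain ⟨v, rfl⟩ := homComplex_acyclic_iff.1 h₁ (n - 1) n (by lia) z hz
  obtain ⟨v', rfl⟩ := Cochain.exists_extension hH v
  exact ⟨δ (n - 1) n v', δ_δ _ _ _ _, by rw [δ_ofHom_comp]⟩

end TwoOfThree

section Contractible

variable {X : CochainComplex A ℤ}

lemma homComplex_acyclic_of_contraction (h : Cochain X X (-1))
    (hh : δ (-1) 0 h = Cochain.ofHom (𝟙 X)) (H : CochainComplex A ℤ) :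
    (HomComplex X H).Acyclic := by
  rw [homComplex_acyclic_iff]
  rintro m n hmn z hz
  -- The sign cancels the one in the Leibniz rule for `δ (h.comp z)`.
  refine ⟨n.negOnePow • h.comp z (by lia), ?_⟩
  rw [δ_units_smul, δ_comp h z (by lia) 0 (n + 1) n (by lia) (by lia) (by lia), hz, hh]
  simp [smul_smul]

/-- A complex spliced together from split short exact sequences is contractible. -/
lemma SplicedBy.exists_contraction {K : ℤ → A} (s : SplicedBy X K)
    (hs : ∀ m n h, ∃ t : K n ⟶ X.X m, t ≫ s.π m n h = 𝟙 _) :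
    ∃ h : Cochain X X (-1), δ (-1) 0 h = Cochain.ofHom (𝟙 X) := by
  choose t ht using hs
  have hr : ∀ m n (hmn : m + 1 = n), ∃ r : X.X m ⟶ K m,
      r ≫ s.ι m = 𝟙 _ - s.π m n hmn ≫ t m n hmn := fun m n hmn =>
    (s.isShortExact m n hmn).exists_lift _ (by simp [ht])
  choose r hr using hr
  -- The homotopy retracts `Xᵃ` onto `Kᵃ`, then lifts to `Xᵃ⁻¹` by the section.
  refine ⟨Cochain.mk fun a b hab => r a (a + 1) rfl ≫ t b a (by lia), ?_⟩
  ext n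
  rw [δ_v (-1) 0 (by lia) _ n n (by lia) (n - 1) (n + 1) (by lia) (by lia)]
  have hri : s.ι (n + 1) ≫ r (n + 1) (n + 1 + 1) rfl = 𝟙 _ := by
    have hz := (s.isShortExact (n + 1) (n + 1 + 1) rfl).zero
    have := (s.isShortExact (n + 1) (n + 1 + 1) rfl).mono
    rw [← cancel_mono (s.ι (n + 1)), Category.assoc, hr]
    simp [reassoc_of% hz]
  have e₁ : t (n - 1) n (by lia) ≫ X.d (n - 1) n = s.ι n := by
    rw [s.d_eq (n - 1) n (by lia), reassoc_of% ht]
  have e₂ : X.d n (n + 1) ≫ r (n + 1) (n + 1 + 1) rfl = s.π n (n + 1) rfl := by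
    rw [s.d_eq n (n + 1) rfl, Category.assoc, hri, Category.comp_id]
  simp [e₁, reassoc_of% e₂, hr]

/-- `Hom(X, H)` is exact if `X` is spliced together from split short exact sequences. -/
lemma SplicedBy.homComplex_acyclic {K : ℤ → A} (s : SplicedBy X K)
    (hs : ∀ m n h, ∃ t : K n ⟶ X.X m, t ≫ s.π m n h = 𝟙 _) (H : CochainComplex A ℤ) :
    (HomComplex X H).Acyclic := by
  obtain ⟨h, hh⟩ := s.exists_contraction hs
  exact homComplex_acyclic_of_contraction h hh H

end Contractible

end HomComplexes

/-! ### Dimension shifting for Ext. -/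

section ExtOrthogonal

open Abelian

variable {A : Type v} [Category.{w} A] [Abelian A] [HasExt.{w'} A]

/-- The class of objects `N` with `Extⁿ(N, B) = 0` for all `n ≥ 1` and all `B` in `ℬ`. -/
def extOrthogonal (ℬ : ObjectProperty A) : ObjectProperty A :=
  fun N => ∀ B, ℬ B → ∀ n : ℕ, Subsingleton (Ext.{w'} N B (n + 1))

namespace IsShortExact

variable {X Y Z B : A} {i : X ⟶ Y} {p : Y ⟶ Z}

lemma exists_extension (h : IsShortExact i p) (hZ : Subsingleton (Ext.{w'} Z B 1)) (f : X ⟶ B) :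
    ∃ g : Y ⟶ B, i ≫ g = f := by
  obtain ⟨w, h⟩ := h
  obtain ⟨x, hx⟩ := Ext.contravariant_sequence_exact₁ h _ (Ext.mk₀ f) (add_zero 1)
    (Subsingleton.elim _ _)
  obtain ⟨g, rfl⟩ := (Ext.mk₀_bijective _ _).2 x
  rw [Ext.mk₀_comp_mk₀] at hx
  exact ⟨g, (Ext.mk₀_bijective _ _).1 hx⟩

lemma subsingleton_ext_left (h : IsShortExact i p) {n : ℕ} (hY : Subsingleton (Ext.{w'} Y B n))
    (hZ : Subsingleton (Ext.{w'} Z B (n + 1))) : Subsingleton (Ext.{w'} X B n) := by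
  obtain ⟨w, h⟩ := h
  refine subsingleton_of_forall_eq 0 fun x => ?_
  obtain ⟨y, rfl⟩ := Ext.contravariant_sequence_exact₁ h _ x (add_comm 1 n) (Subsingleton.elim _ _)
  rw [Subsingleton.elim y 0, Ext.comp_zero]

lemma subsingleton_ext_right (h : IsShortExact i p) {n : ℕ} (hX : Subsingleton (Ext.{w'} X B n))
    (hY : Subsingleton (Ext.{w'} Y B (n + 1))) : Subsingleton (Ext.{w'} Z B (n + 1)) := by
  obtain ⟨w, h⟩ := h
  refine subsingleton_of_forall_eq 0 fun z => ?_
  obtain ⟨x, rfl⟩ := Ext.contravariant_sequence_exact₃ h _ z (Subsingleton.elim _ _) (add_comm 1 n)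
  rw [Subsingleton.elim x 0, Ext.comp_zero]

/-- A class in `Ext¹(Z, B)` dies on `Y`, so it is the pushout of the extension class along some `f :
X ⟶ B`; as `f` factors through `i`, the pushout is zero. -/
lemma subsingleton_ext_one_right (h : IsShortExact i p)
    (hX : ∀ f : X ⟶ B, ∃ g : Y ⟶ B, i ≫ g = f)
    (hY : Subsingleton (Ext.{w'} Y B 1)) : Subsingleton (Ext.{w'} Z B 1) := by
  obtain ⟨w, h⟩ := h
  refine subsingleton_of_forall_eq 0 fun z => ?_
  obtain ⟨x, rfl⟩ := Ext.contravariant_sequence_exact₃ h _ z (Subsingleton.elim _ _) (add_zero 1)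
  obtain ⟨f, rfl⟩ := (Ext.mk₀_bijective _ _).2 x
  obtain ⟨g, rfl⟩ := hX f
  rw [← Ext.mk₀_comp_mk₀]
  exact h.extClass_comp_assoc _

lemma subsingleton_ext_middle (h : IsShortExact i p) {n : ℕ} (hX : Subsingleton (Ext.{w'} X B n))
    (hZ : Subsingleton (Ext.{w'} Z B n)) : Subsingleton (Ext.{w'} Y B n) := by
  obtain ⟨w, h⟩ := h
  refine subsingleton_of_forall_eq 0 fun y => ?_
  obtain ⟨z, rfl⟩ := Ext.contravariant_sequence_exact₂ h _ y (Subsingleton.elim _ _)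
  rw [Subsingleton.elim z 0, Ext.comp_zero]

lemma subsingleton_ext_middle' (h : IsShortExact i p) {N : A} {n : ℕ}
    (hX : Subsingleton (Ext.{w'} N X n)) (hZ : Subsingleton (Ext.{w'} N Z n)) :
    Subsingleton (Ext.{w'} N Y n) := by
  obtain ⟨w, h⟩ := h
  refine subsingleton_of_forall_eq 0 fun y => ?_
  obtain ⟨z, rfl⟩ := Ext.covariant_sequence_exact₂ _ h y (Subsingleton.elim _ _)
  rw [Subsingleton.elim z 0, Ext.zero_comp]

end IsShortExact

lemma subsingleton_ext_of_iso {X Y B B' : A} (e : X ≅ Y) (e' : B ≅ B') {n : ℕ}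
    (h : Subsingleton (Ext.{w'} X B n)) : Subsingleton (Ext.{w'} Y B' n) := by
  refine subsingleton_of_forall_eq 0 fun y => ?_
  have := Subsingleton.elim
    (((Ext.mk₀ e.hom).comp y (zero_add n)).comp (Ext.mk₀ e'.inv) (add_zero n)) 0
  have h₁ : (Ext.mk₀ e.inv).comp ((((Ext.mk₀ e.hom).comp y (zero_add n)).comp (Ext.mk₀ e'.inv)
      (add_zero n)).comp (Ext.mk₀ e'.hom) (add_zero n)) (zero_add n) = y := by
    simp
  rw [← h₁, this, Ext.zero_comp, Ext.comp_zero]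

namespace extOrthogonal

variable {ℬ : ObjectProperty A} {X Y Z : A} {i : X ⟶ Y} {p : Y ⟶ Z}

lemma extendsAlong (hZ : extOrthogonal ℬ Z) (h : IsShortExact i p) : ExtendsAlong ℬ i :=
  fun B hB f => h.exists_extension (hZ B hB 0) f

lemma left (h : IsShortExact i p) (hY : extOrthogonal ℬ Y) (hZ : extOrthogonal ℬ Z) :
    extOrthogonal ℬ X :=
  fun B hB n => h.subsingleton_ext_left (hY B hB n) (hZ B hB (n + 1))

lemma right (h : IsShortExact i p) (hX : extOrthogonal ℬ X) (hY : extOrthogonal ℬ Y)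
    (hi : ExtendsAlong ℬ i) : extOrthogonal ℬ Z := by
  intro B hB n
  cases n with
  | zero => exact h.subsingleton_ext_one_right (hi B hB) (hY B hB 0)
  | succ n => exact h.subsingleton_ext_right (hX B hB n) (hY B hB (n + 1))

lemma middle (h : IsShortExact i p) (hX : extOrthogonal ℬ X) (hZ : extOrthogonal ℬ Z) :
    extOrthogonal ℬ Y :=
  fun B hB n => h.subsingleton_ext_middle (hX B hB n) (hZ B hB n)

lemma of_iso (e : X ≅ Y) (hX : extOrthogonal ℬ X) : extOrthogonal ℬ Y :=
  fun B hB n => subsingleton_ext_of_iso e (Iso.refl B) (hX B hB n)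

lemma of_projective (X : A) [Projective X] : extOrthogonal ℬ X :=
  fun B _ n => Ext.subsingleton_of_projective X B n

/-- The terms of an exact complex with cycles in `ℬ` are `Ext¹`-orthogonal to `extOrthogonal ℬ`. -/
lemma exists_extension_of_cycles (h : IsShortExact i p) (hZ : extOrthogonal ℬ Z)
    {H : CochainComplex A ℤ} (hH : complexesWithCyclesIn ℬ H) (b : ℤ) (f : X ⟶ H.X b) :
    ∃ g : Y ⟶ H.X b, i ≫ g = f :=
  h.exists_extension ((isShortExact_cycles hH.1 b (b + 1) rfl).subsingleton_ext_middle'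
    (hZ _ (hH.2 b) 0) (hZ _ (hH.2 (b + 1)) 0)) f

end extOrthogonal

end ExtOrthogonal

/-- The syzygies of a projective resolution. -/
lemma CategoryTheory.ProjectiveResolution.exists_syzygies {A : Type v} [Category.{w} A] [Abelian A]
    {M : A} (P : ProjectiveResolution M) :
    ∃ (K : ℕ → A) (ι : ∀ n, K (n + 1) ⟶ P.complex.X n) (π : ∀ n, P.complex.X n ⟶ K n),
      (∀ n, IsShortExact (ι n) (π n)) ∧ Nonempty (K 0 ≅ M) := by
  have hmono : ∀ n, Mono (P.complex.fromOpcycles (n + 1) n) := fun n => by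
    generalize hm : n + 1 = m
    obtain rfl : n = (ComplexShape.down ℕ).next m := by simp [← hm]
    exact (hm ▸ P.complex_exactAt_succ _ : P.complex.ExactAt m).mono_fromOpcycles
  have hs : ∀ n, IsShortExact (P.complex.fromOpcycles (n + 1) n) (P.complex.pOpcycles n) := by
    intro n
    refine ⟨by simp [← cancel_epi (P.complex.pOpcycles (n + 1))], ?_⟩
    have := hmono n
    refine { exact := ?_ }
    have hex : (ShortComplex.mk (P.complex.d (n + 1) n) (P.complex.pOpcycles n) (by simp)).Exact :=
      ShortComplex.exact_of_g_is_cokernel _ (P.complex.opcyclesIsCokernel (n + 1) n (by simp))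
    exact (ShortComplex.exact_iff_of_epi_of_isIso_of_mono
      (S₁ := ShortComplex.mk (P.complex.d (n + 1) n) (P.complex.pOpcycles n) (by simp))
      (S₂ := ShortComplex.mk (P.complex.fromOpcycles (n + 1) n) (P.complex.pOpcycles n)
        (by simp [← cancel_epi (P.complex.pOpcycles (n + 1))]))
      { τ₁ := P.complex.pOpcycles (n + 1), τ₂ := 𝟙 _, τ₃ := 𝟙 _ }).1 hex
  refine ⟨fun n => P.complex.opcycles n, fun n => P.complex.fromOpcycles (n + 1) n,
    fun n => P.complex.pOpcycles n, hs, (hs 0).nonempty_iso_right (p' := P.π.f 0) ?_⟩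
  have hw : P.complex.fromOpcycles (0 + 1) 0 ≫ P.π.f 0 = 0 := by
    rw [← cancel_epi (P.complex.pOpcycles (0 + 1))]
    rw [P.complex.p_fromOpcycles_assoc, comp_zero]
    exact P.complex_d_comp_π_f_zero
  have := hmono 0
  refine ⟨hw, { exact := ?_, epi_g := inferInstanceAs (Epi (P.π.f 0)) }⟩
  exact (ShortComplex.exact_iff_of_epi_of_isIso_of_mono
    (S₁ := ShortComplex.mk (P.complex.d 1 0) (P.π.f 0) P.complex_d_comp_π_f_zero)
    (S₂ := ShortComplex.mk (P.complex.fromOpcycles 1 0) (P.π.f 0) hw)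
    { τ₁ := P.complex.pOpcycles 1, τ₂ := 𝟙 _, τ₃ := 𝟙 _
      comm₂₃ := (Category.id_comp _).trans (Category.comp_id _).symm }).1 P.exact₀

/-! ### Tensor evaluation and extension of linear maps. -/

section TensorHom

open TensorProduct TensorProduct.AlgebraTensorModule

variable {R : Type u} [CommRing R] {N P C F B Q : Type*} [AddCommGroup N] [Module R N]
  [AddCommGroup P] [Module R P] [AddCommGroup C] [Module R C] [AddCommGroup F] [Module R F]
  [AddCommGroup B] [Module R B] [AddCommGroup Q] [Module R Q]

lemma rTensorHomToHomRTensor_lcomp (f : P →ₗ[R] N) (x : (N →ₗ[R] C) ⊗[R] F) :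
    rTensorHomToHomRTensor (.id R) P C F ((LinearMap.lcomp R C f).rTensor F x) =
      rTensorHomToHomRTensor (.id R) N C F x ∘ₗ f := by
  induction x with
  | zero => simp
  | tmul g y => ext; simp
  | add x y hx hy => rw [map_add, map_add, map_add, LinearMap.add_comp, hx, hy]

/-- `Hom(N, C) ⊗ F → Hom(N, C ⊗ F)` is surjective for `N` finitely presented and `F` flat. -/
lemma rTensorHomToHomRTensor_surjective [Module.FinitePresentation R N] [Module.Flat R F] :
    Function.Surjective (rTensorHomToHomRTensor (.id R) N C F) := by
  intro φ
  obtain ⟨n, f, hf⟩ := Module.Finite.exists_fin' R N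
  have hker := Module.FinitePresentation.fg_ker f hf
  have := Module.Finite.iff_fg.2 hker
  obtain ⟨m, g', hg'⟩ := Module.Finite.exists_fin' R (LinearMap.ker f)
  let g := (LinearMap.ker f).subtype ∘ₗ g'
  have hfg : Function.Exact g f := by
    rw [LinearMap.exact_iff, LinearMap.range_comp, LinearMap.range_eq_top.2 hg']
    simp
  have hex : Function.Exact (LinearMap.lcomp R C f) (LinearMap.lcomp R C g) :=
    LinearMap.exact_lcomp_of_exact_of_surjective _ hfg hf
  have hex' := Module.Flat.rTensor_exact F hex
  have hbij : ∀ k, Function.Bijective (rTensorHomToHomRTensor (.id R) (Fin k → R) C F) := by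
    intro k
    rw [← rTensorHomEquivHomRTensor_toLinearMap]
    exact (rTensorHomEquivHomRTensor R (Fin k → R) C F).bijective
  -- A diagram chase on the presentation `Rᵐ → Rⁿ → N`: evaluation is bijective on free modules of
  -- finite rank, and `- ⊗ F` keeps the row of Homs into `C` exact.
  obtain ⟨y, hy⟩ := (hbij n).2 (φ ∘ₗ f)
  obtain ⟨x, rfl⟩ := (hex' y).1 <| (hbij m).1 <| by
    rw [rTensorHomToHomRTensor_lcomp, hy, LinearMap.comp_assoc, hfg.linearMap_comp_eq_zero]
    simp
  refine ⟨x, ?_⟩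
  rw [rTensorHomToHomRTensor_lcomp] at hy
  exact (LinearMap.cancel_right hf).1 hy

lemma lcomp_tensor_surjective [Module.FinitePresentation R N] [Module.Flat R F] (i : N →ₗ[R] P)
    (hi : Function.Surjective (LinearMap.lcomp R C i)) :
    Function.Surjective (LinearMap.lcomp R (C ⊗[R] F) i) := by
  intro φ
  obtain ⟨x, rfl⟩ := rTensorHomToHomRTensor_surjective φ
  obtain ⟨y, rfl⟩ := LinearMap.rTensor_surjective F hi x
  exact ⟨_, (rTensorHomToHomRTensor_lcomp i y).symm⟩

/-- By adjunction, `N ⊗ Q → B` is a map `Q → Hom(N, B)`, which lifts to `Hom(P, B)` because `Q` is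
projective. -/
lemma lcomp_rTensor_surjective [Module.Projective R Q] (i : N →ₗ[R] P)
    (hi : Function.Surjective (LinearMap.lcomp R B i)) :
    Function.Surjective (LinearMap.lcomp R B (i.rTensor Q)) := by
  intro φ
  obtain ⟨ψ, hψ⟩ := Module.projective_lifting_property (LinearMap.lcomp R B i)
    (TensorProduct.curry φ).flip hi
  refine ⟨TensorProduct.lift ψ.flip, ?_⟩
  ext x q
  have := LinearMap.congr_fun (LinearMap.congr_fun hψ q) x
  simpa using this

end TensorHom

/-! ### Ext vanishing for semidualizing modules. -/

section Semidualizing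

open TensorProduct

variable {R : Type u} [CommRing R]

lemma isShortExact_ofHom {X Y Z : Type u} [AddCommGroup X] [Module R X] [AddCommGroup Y]
    [Module R Y] [AddCommGroup Z] [Module R Z] (f : X →ₗ[R] Y) (g : Y →ₗ[R] Z)
    (hf : Function.Injective f) (hg : Function.Surjective g) (hfg : Function.Exact f g) :
    IsShortExact (ModuleCat.ofHom f) (ModuleCat.ofHom g) := by
  refine ⟨by rw [← ModuleCat.ofHom_comp, hfg.linearMap_comp_eq_zero]; rfl, ?_⟩
  exact ModuleCat.shortComplex_shortExact _ hfg hf hg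

namespace IsShortExact

variable {X Y Z : ModuleCat.{u} R} {f : X ⟶ Y} {g : Y ⟶ Z}

lemma injective (h : IsShortExact f g) : Function.Injective f :=
  h.2.moduleCat_injective_f

lemma surjective (h : IsShortExact f g) : Function.Surjective g :=
  h.2.moduleCat_surjective_g

lemma exact (h : IsShortExact f g) : Function.Exact f g :=
  (ShortComplex.ShortExact.moduleCat_exact_iff_function_exact _).1 h.2.exact

lemma rTensor (h : IsShortExact f g) (Q : Type u) [AddCommGroup Q] [Module R Q]
    [Module.Flat R Q] :
    IsShortExact (ModuleCat.ofHom (f.hom.rTensor Q)) (ModuleCat.ofHom (g.hom.rTensor Q)) :=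
  isShortExact_ofHom _ _ (Module.Flat.rTensor_preserves_injective_linearMap _ h.injective)
    (LinearMap.rTensor_surjective Q h.surjective) (_root_.rTensor_exact Q h.exact h.surjective)

end IsShortExact

variable {C : ModuleCat.{u} R}

lemma IsSemidualizing.exists_syzygies (hC : IsSemidualizing C) :
    ∃ (K P : ℕ → ModuleCat.{u} R) (ι : ∀ n, K (n + 1) ⟶ P n) (π : ∀ n, P n ⟶ K n),
      (∀ n, IsShortExact (ι n) (π n)) ∧ (∀ n, Module.Projective R (P n)) ∧
      (∀ n, Module.FinitePresentation R (K n)) ∧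
      (∀ n i : ℕ, Subsingleton (Abelian.Ext.{u} (K n) C (i + 1))) ∧ Nonempty (K 0 ≅ C) := by
  obtain ⟨P, hP⟩ := hC.exists_resolution
  obtain ⟨K, ι, π, hs, ⟨e⟩⟩ := P.exists_syzygies
  have hproj : ∀ n, Module.Projective R (P.complex.X n) := fun n => inferInstance
  have hfin : ∀ n, Module.Finite R (K n) := fun n =>
    have := hP n
    Module.Finite.of_surjective (π n).hom (hs n).surjective
  refine ⟨K, fun n => P.complex.X n, ι, π, hs, hproj, fun n => ?_, fun n => ?_, ⟨e⟩⟩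
  · have := hP n
    have := hfin (n + 1)
    have := Module.finitePresentation_of_projective R (P.complex.X n)
    refine Module.finitePresentation_of_surjective (π n).hom (hs n).surjective ?_
    rw [(LinearMap.exact_iff (f := (ι n).hom) (g := (π n).hom)).1 (hs n).exact]
    exact Module.Finite.iff_fg.1 inferInstance
  · induction n with
    | zero =>
      exact fun i => subsingleton_ext_of_iso e.symm (Iso.refl C) (hC.ext_eq_zero _ (by lia))
    | succ n ih =>
      exact fun i => (hs n).subsingleton_ext_left
        (Abelian.Ext.subsingleton_of_projective _ _ _) (ih (i + 1))

/-- `Extⁱ(C ⊗ P, C ⊗ F) = 0` for `i ≥ 1`, `P` projective and `F` flat. -/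
lemma IsSemidualizing.extOrthogonal_of_cProjective (hC : IsSemidualizing C) {V : ModuleCat.{u} R}
    (hV : cProjectiveModules C V) : extOrthogonal (cFlatModules C) V := by
  obtain ⟨Q, hQ, ⟨eV⟩⟩ := hV
  rintro B ⟨F, hF, ⟨eB⟩⟩ i
  obtain ⟨K, P, ι, π, hs, hP, hK, hE, ⟨e⟩⟩ := hC.exists_syzygies
  -- All syzygies are treated at once, since raising the Ext degree replaces `K n` by `K (n + 1)`.
  have key : ∀ i n : ℕ, Subsingleton (Abelian.Ext.{u} (ModuleCat.of R (K n ⊗[R] Q))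
      (ModuleCat.of R (C ⊗[R] F)) (i + 1)) := by
    intro i
    induction i with
    | zero =>
      intro n
      refine ((hs n).rTensor Q).subsingleton_ext_one_right (fun f => ?_)
        (Abelian.Ext.subsingleton_of_projective (ModuleCat.of R (P n ⊗[R] Q)) _ 0)
      have h₁ : Function.Surjective (LinearMap.lcomp R C (ι n).hom) := fun f => by
        obtain ⟨g, hg⟩ := (hs n).exists_extension (hE n 0) (ModuleCat.ofHom f)
        exact ⟨g.hom, congrArg ModuleCat.Hom.hom hg⟩
      obtain ⟨g, hg⟩ := lcomp_rTensor_surjective (Q := Q) _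
        (lcomp_tensor_surjective (F := F) _ h₁) f.hom
      exact ⟨ModuleCat.ofHom g, ModuleCat.hom_ext hg⟩
    | succ i ih =>
      intro n
      exact ((hs n).rTensor Q).subsingleton_ext_right (ih (n + 1))
        (Abelian.Ext.subsingleton_of_projective (ModuleCat.of R (P n ⊗[R] Q)) _ _)
  refine subsingleton_ext_of_iso (LinearEquiv.toModuleIso ?_) (LinearEquiv.toModuleIso ?_) (key i 0)
  · exact (TensorProduct.congr e.toLinearEquiv (LinearEquiv.refl R Q)).trans eV.symm
  · exact eB.symm

end Semidualizing

/-! ### Coresolutions with Ext-orthogonal cosyzygies. -/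

section Coresolutions

variable {A : Type v} [Category.{w} A] [Abelian A] [HasExt.{w'} A]

/-- The class of objects with a `Hom(-, ℬ)`-exact coresolution by objects of `𝒱`, all of whose
cosyzygies are in `extOrthogonal ℬ`. -/
def coresolved (𝒱 ℬ : ObjectProperty A) : ObjectProperty A := fun M =>
  ∃ 𝒮 : ObjectProperty A, 𝒮 M ∧ ∀ N, 𝒮 N → extOrthogonal ℬ N ∧
    ∃ (V N' : A) (i : N ⟶ V) (p : V ⟶ N'), 𝒱 V ∧ 𝒮 N' ∧ IsShortExact i p

namespace coresolved

variable {𝒰 𝒱 ℬ : ObjectProperty A} {M : A}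

lemma mem_extOrthogonal (hM : coresolved 𝒱 ℬ M) : extOrthogonal ℬ M := by
  obtain ⟨𝒮, hM, h⟩ := hM
  exact (h M hM).1

lemma exists_step (hM : coresolved 𝒱 ℬ M) : ∃ (V N : A) (i : M ⟶ V) (p : V ⟶ N),
    𝒱 V ∧ coresolved 𝒱 ℬ N ∧ IsShortExact i p := by
  obtain ⟨𝒮, hM, h⟩ := hM
  obtain ⟨V, N, i, p, hV, hN, hip⟩ := (h M hM).2
  exact ⟨V, N, i, p, hV, ⟨𝒮, hN, h⟩, hip⟩

lemma of_step (hM : extOrthogonal ℬ M) {V N : A} {i : M ⟶ V} {p : V ⟶ N} (hV : 𝒱 V)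
    (hN : coresolved 𝒱 ℬ N) (h : IsShortExact i p) : coresolved 𝒱 ℬ M := by
  refine ⟨fun M' => M' = M ∨ coresolved 𝒱 ℬ M', Or.inl rfl, ?_⟩
  rintro M' (rfl | hM')
  · exact ⟨hM, V, N, i, p, hV, Or.inr hN, h⟩
  · obtain ⟨V, N, i, p, hV, hN, hip⟩ := hM'.exists_step
    exact ⟨hM'.mem_extOrthogonal, V, N, i, p, hV, Or.inr hN, hip⟩

lemma of_iso {M' : A} (e : M ≅ M') (hM : coresolved 𝒱 ℬ M) : coresolved 𝒱 ℬ M' := by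
  obtain ⟨V, N, i, p, hV, hN, hip⟩ := hM.exists_step
  exact of_step (extOrthogonal.of_iso e hM.mem_extOrthogonal) hV hN (hip.of_iso_left e.symm)

/-- The projective half gives the Ext vanishing for `K 1`, by shifting leftwards; the other half
carries it to all later cosyzygies. -/
lemma of_isImageInCompleteResolution (hU : ∀ U, 𝒰 U → Projective U)
    (hV : ∀ V, 𝒱 V → extOrthogonal ℬ V)
    (hM : IsImageInCompleteResolution 𝒰 𝒱 ℬ M) : coresolved 𝒱 ℬ M := by
  obtain ⟨L, K, s, hB, hLU, hLV, ⟨e⟩⟩ := hM.exists_splicedBy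
  have h₁ : ∀ (B : A), ℬ B → ∀ (i : ℕ) (m : ℤ), m ≤ 0 →
      Subsingleton (Abelian.Ext.{w'} (K (m + 1)) B (i + 1)) := by
    intro B hBB i
    induction i with
    | zero =>
      intro m hm
      have := hU _ (hLU m hm)
      exact (s.isShortExact m _ rfl).subsingleton_ext_one_right (hB m B hBB)
        (Abelian.Ext.subsingleton_of_projective _ _ _)
    | succ i ih =>
      intro m hm
      have := hU _ (hLU m hm)
      have h := ih (m - 1) (by lia)
      rw [sub_add_cancel] at h
      exact (s.isShortExact m _ rfl).subsingleton_ext_right h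
        (Abelian.Ext.subsingleton_of_projective _ _ _)
  have h₂ : ∀ n : ℕ, extOrthogonal ℬ (K (n + 1)) := by
    intro n
    induction n with
    | zero => exact fun B hBB i => h₁ B hBB i 0 le_rfl
    | succ n ih =>
      push_cast
      exact extOrthogonal.right (s.isShortExact _ _ rfl) ih (hV _ (hLV _ (by lia))) (hB _)
  refine of_iso e.symm ⟨fun N => ∃ n : ℕ, N = K (n + 1), ⟨0, by simp⟩, ?_⟩
  rintro _ ⟨n, rfl⟩
  exact ⟨h₂ n, L.X (n + 1), K (n + 1 + 1), s.ι _, s.π _ _ rfl, hLV _ (by lia),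
    ⟨n + 1, by push_cast; rfl⟩, s.isShortExact _ _ rfl⟩

end coresolved

end Coresolutions

section ProductCoresolutions

variable {R : Type u} [CommRing R]

lemma isShortExact_inl_snd (X Y : ModuleCat.{u} R) :
    IsShortExact (ModuleCat.ofHom (LinearMap.inl R X Y)) (ModuleCat.ofHom (LinearMap.snd R X Y)) :=
  isShortExact_ofHom _ _ LinearMap.inl_injective LinearMap.snd_surjective .inl_snd

variable {𝒱 ℬ : ObjectProperty (ModuleCat.{u} R)}

/-- The factor `W` is absorbed at once: `M × W` embeds in `V × W` with the old cokernel `N`. -/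
lemma coresolved.prod (h𝒱 : ∀ V W : ModuleCat.{u} R, 𝒱 V → 𝒱 W → 𝒱 (ModuleCat.of R (V × W)))
    {M W : ModuleCat.{u} R} (hM : coresolved 𝒱 ℬ M) (hW : 𝒱 W) (hW' : extOrthogonal ℬ W) :
    coresolved 𝒱 ℬ (ModuleCat.of R (M × W)) := by
  obtain ⟨V, N, i, p, hV, hN, hip⟩ := hM.exists_step
  refine of_step (.middle (isShortExact_inl_snd M W) hM.mem_extOrthogonal hW') (h𝒱 V W hV hW) hN
    (isShortExact_ofHom (i.hom.prodMap LinearMap.id) (p.hom ∘ₗ LinearMap.fst R V W) ?_ ?_ ?_)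
  · exact hip.injective.prodMap Function.injective_id
  · exact hip.surjective.comp Prod.fst_surjective
  · rintro ⟨v, w⟩
    constructor
    · intro h
      obtain ⟨m, hm⟩ := (hip.exact v).1 h
      exact ⟨(m, w), Prod.ext hm rfl⟩
    · rintro ⟨⟨m, w'⟩, h⟩
      obtain ⟨rfl, -⟩ := Prod.ext_iff.1 h
      exact (hip.exact _).2 ⟨m, rfl⟩

/-- If `M ⟶ V` is a monomorphism with cokernel in `coresolved 𝒱 ℬ`, then the cokernel of any
`(i, ψ) : M ⟶ V × W` with `W` in `𝒱` is in `coresolved 𝒱 ℬ`. -/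
lemma coresolved.of_prod (h𝒱 : ∀ V W : ModuleCat.{u} R, 𝒱 V → 𝒱 W → 𝒱 (ModuleCat.of R (V × W)))
    {M V W N Y : ModuleCat.{u} R} {i : M ⟶ V} {p : V ⟶ N} (hip : IsShortExact i p)
    (hN : coresolved 𝒱 ℬ N) (hW : 𝒱 W) (hW' : extOrthogonal ℬ W) (hWB : ℬ W)
    (f : M ⟶ ModuleCat.of R (V × W)) {q : ModuleCat.of R (V × W) ⟶ Y} (hq : IsShortExact f q)
    (hf : ∀ x, (f x).1 = i x) :
    coresolved 𝒱 ℬ Y := by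
  obtain ⟨s, hs⟩ := hN.mem_extOrthogonal.extendsAlong hip W hWB
    (ModuleCat.ofHom (LinearMap.snd R V W ∘ₗ f.hom))
  have hs' : ∀ x, s (i x) = (f x).2 := fun x => congrArg (fun φ => φ x) hs
  -- The shear `(v, w) ↦ (v, w - s v)` turns `f` into `(i, 0)`, whose cokernel is `N × W`.
  have h : IsShortExact f (ModuleCat.ofHom ((p.hom ∘ₗ LinearMap.fst R V W).prod
      (LinearMap.snd R V W - s.hom ∘ₗ LinearMap.fst R V W))) := by
    refine isShortExact_ofHom f.hom _ hq.injective ?_ ?_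
    · rintro ⟨n, w⟩
      obtain ⟨v, rfl⟩ := hip.surjective n
      exact ⟨(v, w + s v), by simp⟩
    · rintro ⟨v, w⟩
      constructor
      · intro h
        obtain ⟨h₁, h₂⟩ := Prod.ext_iff.1 h
        obtain ⟨m, rfl⟩ := (hip.exact v).1 h₁
        refine ⟨m, Prod.ext (hf m) ?_⟩
        have h₂ : w - s (i m) = 0 := h₂
        exact (hs' m).symm.trans (sub_eq_zero.1 h₂).symm
      · rintro ⟨m, hm⟩
        obtain ⟨h₁, h₂⟩ := Prod.ext_iff.1 hm
        have hv : i m = v := (hf m).symm.trans h₁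
        have hw : s (i m) = w := (hs' m).trans h₂
        subst hv
        exact Prod.ext ((hip.exact _).2 ⟨m, rfl⟩) (sub_eq_zero.2 hw.symm)
  obtain ⟨e⟩ := h.nonempty_iso_right hq
  exact of_iso e (hN.prod h𝒱 hW hW')

end ProductCoresolutions

/-! ### Disk complexes. -/

section Disks

variable {R : Type u} [CommRing R]

/-- The product of disk complexes with terms `Qⁿ × Qⁿ⁺¹` and differential `(a, b) ↦ (b, 0)`. -/
noncomputable def diskComplex (Q : ℤ → ModuleCat.{u} R) : CochainComplex (ModuleCat.{u} R) ℤ :=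
  spliceComplex (K := Q) (L := fun n => ModuleCat.of R (Q n × Q (n + 1)))
    (fun n => ModuleCat.ofHom (LinearMap.inl R (Q n) (Q (n + 1))))
    (fun m _ h => ModuleCat.ofHom (LinearMap.snd R (Q m) (Q (m + 1))) ≫
      (eqToIso (congrArg Q h)).hom)
    (fun m _ _ => (isShortExact_inl_snd (Q m) (Q (m + 1))).of_iso_right _)

namespace diskComplex

variable (Q : ℤ → ModuleCat.{u} R)

/-- A disk complex is spliced together from split short exact sequences. -/
noncomputable def splicedBy : SplicedBy (diskComplex Q) Q :=
  splicedBySpliceComplex _ _ _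

lemma d_eq (n : ℤ) : (diskComplex Q).d n (n + 1) =
    ModuleCat.ofHom (LinearMap.inl R (Q (n + 1)) (Q (n + 1 + 1)) ∘ₗ
      LinearMap.snd R (Q n) (Q (n + 1))) := by
  rw [(splicedBy Q).d_eq n (n + 1) rfl]
  rfl

lemma homComplex_acyclic (H : CochainComplex (ModuleCat.{u} R) ℤ) :
    (CochainComplex.HomComplex (diskComplex Q) H).Acyclic := by
  refine (splicedBy Q).homComplex_acyclic ?_ H
  rintro m _ rfl
  exact ⟨ModuleCat.ofHom (LinearMap.inr R (Q m) (Q (m + 1))), rfl⟩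

lemma complexesWithCyclesIn {𝒳 : ObjectProperty (ModuleCat.{u} R)} [𝒳.IsClosedUnderIsomorphisms]
    (hQ : ∀ n, 𝒳 (Q n)) : complexesWithCyclesIn 𝒳 (diskComplex Q) := by
  refine ⟨(splicedBy Q).acyclic, fun n => ?_⟩
  obtain ⟨e⟩ := (splicedBy Q).nonempty_cyclesIso n
  exact 𝒳.prop_of_iso e.symm (hQ n)

variable {Q} {X : CochainComplex (ModuleCat.{u} R) ℤ}

/-- The morphism to a disk complex given by a family of linear maps `Xⁿ ⟶ Qⁿ`. -/
noncomputable def lift (φ : ∀ n, X.X n ⟶ Q n) : X ⟶ diskComplex Q where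
  f n := ModuleCat.ofHom ((φ n).hom.prod ((φ (n + 1)).hom ∘ₗ (X.d n (n + 1)).hom))
  comm' := by
    rintro n _ rfl
    rw [d_eq]
    ext x
    refine Prod.ext rfl ?_
    change 0 = φ (n + 1 + 1) (X.d (n + 1) (n + 1 + 1) (X.d n (n + 1) x))
    have h : X.d (n + 1) (n + 1 + 1) (X.d n (n + 1) x) = 0 := by
      rw [← ModuleCat.comp_apply, X.d_comp_d]
      rfl
    rw [h, map_zero]

variable (Q) in
/-- The projection `Qⁿ × Qⁿ⁺¹ ⟶ Qⁿ`. -/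
noncomputable def fst (n : ℤ) : (diskComplex Q).X n ⟶ Q n :=
  ModuleCat.ofHom (LinearMap.fst R (Q n) (Q (n + 1)))

lemma lift_f_fst (φ : ∀ n, X.X n ⟶ Q n) (n : ℤ) : (lift φ).f n ≫ fst Q n = φ n := rfl

lemma mono_lift (φ : ∀ n, X.X n ⟶ Q n) (hφ : ∀ n, Mono (φ n)) : Mono (lift φ) := by
  have : ∀ n, Mono ((lift φ).f n) := fun n => by
    rw [ModuleCat.mono_iff_injective]
    exact fun x y h => (ModuleCat.mono_iff_injective _).1 (hφ n) (congrArg Prod.fst h)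
  exact HomologicalComplex.mono_of_mono_f _ this

/-- The morphism from a disk complex given by a family of linear maps `Qⁿ⁺¹ ⟶ Xⁿ`. -/
noncomputable def desc (ψ : ∀ m n, m + 1 = n → (Q n ⟶ X.X m)) : diskComplex Q ⟶ X where
  f n := ModuleCat.ofHom (LinearMap.coprod
    ((X.d (n - 1) n).hom ∘ₗ (ψ (n - 1) n (by lia)).hom) (ψ n (n + 1) rfl).hom)
  comm' := by
    rintro n _ rfl
    rw [d_eq]
    -- Indexing `ψ` by pairs with `m + 1 = n` lets `n + 1 - 1` and `n` be identified by
    -- substitution.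
    have e : ∀ m n (h : m + 1 = n) (y : Q n), X.d (n - 1) n (ψ (n - 1) n (by lia) y) =
        X.d m n (ψ m n h y) := by
      intro m n h y
      obtain rfl : m = n - 1 := by lia
      rfl
    ext x
    obtain ⟨a, b⟩ := x
    change X.d n (n + 1) (X.d (n - 1) n (ψ (n - 1) n (by lia) a) + ψ n (n + 1) rfl b) =
      X.d (n + 1 - 1) (n + 1) (ψ (n + 1 - 1) (n + 1) (by lia) b) + ψ (n + 1) (n + 1 + 1) rfl 0
    rw [e n (n + 1) rfl b, map_add, map_zero, add_zero, ← ModuleCat.comp_apply, X.d_comp_d]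
    simp

lemma epi_desc (ψ : ∀ m n, m + 1 = n → (Q n ⟶ X.X m)) (hψ : ∀ m n h, Epi (ψ m n h)) :
    Epi (desc ψ) := by
  have : ∀ n, Epi ((desc ψ).f n) := fun n => by
    rw [ModuleCat.epi_iff_surjective]
    intro x
    obtain ⟨y, rfl⟩ := (ModuleCat.epi_iff_surjective _).1 (hψ n (n + 1) rfl) x
    refine ⟨((0, y) : Q n × Q (n + 1)), ?_⟩
    change X.d (n - 1) n (ψ (n - 1) n (by lia) 0) + _ = _
    simp
  exact HomologicalComplex.epi_of_epi_f _ this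

end diskComplex

end Disks

/-! ### Shifts, products and terms in the relevant classes. -/

section ExactComplexes

variable {A : Type v} [Category.{w} A] [Abelian A]

open CochainComplex in
lemma complexesWithCyclesIn_shift {𝒳 : ObjectProperty A} [𝒳.IsClosedUnderIsomorphisms]
    {H : CochainComplex A ℤ} (hH : complexesWithCyclesIn 𝒳 H) (n : ℤ) :
    complexesWithCyclesIn 𝒳 (H⟦n⟧) := by
  refine ⟨fun i => ?_, fun i => ?_⟩
  · exact (ShortComplex.exact_iff_of_iso
      ((CochainComplex.shiftShortComplexFunctorIso A n i _ rfl).app H)).2 (hH.1 (n + i))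
  · exact 𝒳.prop_of_iso (ShortComplex.cyclesMapIso
      ((CochainComplex.shiftShortComplexFunctorIso A n i _ rfl).app H)).symm (hH.2 (n + i))

end ExactComplexes

section ModuleClasses

variable {R : Type u} [CommRing R]

instance : (projectiveModules R).IsClosedUnderIsomorphisms where
  of_iso e h := by
    have : Module.Projective R _ := h
    exact Module.Projective.of_equiv e.toLinearEquiv

instance (C : ModuleCat.{u} R) : (cProjectiveModules C).IsClosedUnderIsomorphisms where
  of_iso e h := by
    obtain ⟨P, hP, ⟨e'⟩⟩ := h
    exact ⟨P, hP, ⟨e.symm.toLinearEquiv.trans e'⟩⟩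

instance (C : ModuleCat.{u} R) : (cFlatModules C).IsClosedUnderIsomorphisms where
  of_iso e h := by
    obtain ⟨P, hP, ⟨e'⟩⟩ := h
    exact ⟨P, hP, ⟨e.symm.toLinearEquiv.trans e'⟩⟩

lemma projectiveModules_prod (V W : ModuleCat.{u} R) (hV : projectiveModules R V)
    (hW : projectiveModules R W) : projectiveModules R (ModuleCat.of R (V × W)) := by
  have : Module.Projective R V := hV
  have : Module.Projective R W := hW
  exact inferInstanceAs (Module.Projective R (V × W))

lemma cProjectiveModules_prod {C : ModuleCat.{u} R} (V W : ModuleCat.{u} R)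
    (hV : cProjectiveModules C V) (hW : cProjectiveModules C W) :
    cProjectiveModules C (ModuleCat.of R (V × W)) := by
  obtain ⟨P, hP, ⟨e⟩⟩ := hV
  obtain ⟨Q, hQ, ⟨e'⟩⟩ := hW
  exact ⟨ModuleCat.of R (P × Q), inferInstanceAs (Module.Projective R (P × Q)),
    ⟨(e.prodCongr e').trans (TensorProduct.prodRight R R C P Q).symm⟩⟩

lemma cFlatModules_of_cProjectiveModules {C V : ModuleCat.{u} R} (hV : cProjectiveModules C V) :
    cFlatModules C V := by
  obtain ⟨P, hP, e⟩ := hV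
  exact ⟨P, inferInstance, e⟩

/-- The middle term of a short exact sequence with outer terms in `𝒳` is in `𝒳`, if
`Ext¹(𝒳, 𝒳) = 0` and `𝒳` is closed under products. -/
lemma IsShortExact.prop_middle {𝒳 : ObjectProperty (ModuleCat.{u} R)}
    [𝒳.IsClosedUnderIsomorphisms]
    (h𝒳 : ∀ V W : ModuleCat.{u} R, 𝒳 V → 𝒳 W → 𝒳 (ModuleCat.of R (V × W)))
    {X Y Z : ModuleCat.{u} R} {i : X ⟶ Y} {p : Y ⟶ Z} (h : IsShortExact i p)
    (hX : 𝒳 X) (hZ : 𝒳 Z) (hZ' : extOrthogonal 𝒳 Z) : 𝒳 Y := by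
  obtain ⟨r, hr⟩ := hZ'.extendsAlong h X hX (𝟙 X)
  obtain ⟨e, -⟩ := h.exact.splitInjectiveEquiv h.surjective
    ⟨r.hom, congrArg ModuleCat.Hom.hom hr⟩
  exact 𝒳.prop_of_iso e.symm.toModuleIso (h𝒳 X Z hX hZ)

/-- Each term is an extension of one cycle module by another, and such an extension splits. -/
lemma complexesWithCyclesIn.prop_X {𝒳 : ObjectProperty (ModuleCat.{u} R)}
    [𝒳.IsClosedUnderIsomorphisms]
    (h𝒳 : ∀ V W : ModuleCat.{u} R, 𝒳 V → 𝒳 W → 𝒳 (ModuleCat.of R (V × W)))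
    (h𝒳' : ∀ V, 𝒳 V → extOrthogonal 𝒳 V) {X : CochainComplex (ModuleCat.{u} R) ℤ}
    (hX : complexesWithCyclesIn 𝒳 X) (n : ℤ) : 𝒳 (X.X n) :=
  (isShortExact_cycles hX.1 n (n + 1) rfl).prop_middle h𝒳 (hX.2 n) (hX.2 (n + 1))
    (h𝒳' _ (hX.2 (n + 1)))

lemma extOrthogonal_projectiveModules {ℬ : ObjectProperty (ModuleCat.{u} R)} {V : ModuleCat.{u} R}
    (hV : projectiveModules R V) : extOrthogonal ℬ V := by
  have : Module.Projective R V := hV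
  exact extOrthogonal.of_projective V

lemma projectiveComplexes.prop_X {X : CochainComplex (ModuleCat.{u} R) ℤ}
    (hX : projectiveComplexes R X) (n : ℤ) : projectiveModules R (X.X n) :=
  complexesWithCyclesIn.prop_X projectiveModules_prod
    (fun _ => extOrthogonal_projectiveModules) hX n

lemma projectiveComplexes.homComplex_acyclic {X : CochainComplex (ModuleCat.{u} R) ℤ}
    (hX : projectiveComplexes R X) (H : CochainComplex (ModuleCat.{u} R) ℤ) :
    (CochainComplex.HomComplex X H).Acyclic := by
  refine (SplicedBy.cycles hX.1).homComplex_acyclic (fun m n h => ?_) H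
  have : Module.Projective R (X.cycles n) := hX.2 n
  have := (isShortExact_cycles hX.1 m n h).epi
  exact ⟨Projective.factorThru (𝟙 _) (X.toCycles m n), Projective.factorThru_comp _ _⟩

lemma IsSemidualizing.prop_X {C : ModuleCat.{u} R} (hC : IsSemidualizing C)
    {X : CochainComplex (ModuleCat.{u} R) ℤ} (hX : cProjectiveComplexes C X) (n : ℤ) :
    cProjectiveModules C (X.X n) :=
  complexesWithCyclesIn.prop_X cProjectiveModules_prod
    (fun _ hV B hB => hC.extOrthogonal_of_cProjective hV B
      (cFlatModules_of_cProjectiveModules hB)) hX n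

end ModuleClasses

/-! ### The two directions of the theorem. -/

section DCProjective

variable {R : Type u} [CommRing R] {C : ModuleCat.{u} R} {X : CochainComplex (ModuleCat.{u} R) ℤ}

/-- The terms of a morphism of complexes inherit extension properties, by testing against disk
complexes. -/
lemma ExtendsAlong.eval {𝒳 : ObjectProperty (ModuleCat.{u} R)} [𝒳.IsClosedUnderIsomorphisms]
    {Y Z : CochainComplex (ModuleCat.{u} R) ℤ} {i : Y ⟶ Z}
    (h : ExtendsAlong (complexesWithCyclesIn 𝒳) i) (n : ℤ) : ExtendsAlong 𝒳 (i.f n) := by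
  intro B hB f
  obtain ⟨g, hg⟩ := h _ (diskComplex.complexesWithCyclesIn (fun _ => B) fun _ => hB)
    -- A chain map to a disk complex is an arbitrary family of linear maps, so `f` can be placed in
    -- degree `n` with zeros elsewhere.
    (diskComplex.lift fun m => if hm : m = n then (eqToIso (congrArg Y.X hm)).hom ≫ f else 0)
  refine ⟨g.f n ≫ diskComplex.fst _ n, ?_⟩
  rw [← Category.assoc, ← HomologicalComplex.comp_f, hg]
  refine (diskComplex.lift_f_fst (Q := fun _ => B) _ n).trans ?_
  simp

lemma IsDCProjectiveComplex.isDCProjectiveModule (hC : IsSemidualizing C)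
    (hX : IsDCProjectiveComplex C X) (n : ℤ) : IsDCProjectiveModule C (X.X n) := by
  obtain ⟨L, K, s, hB, hU, hV, ⟨e⟩⟩ := hX.exists_splicedBy
  exact IsImageInCompleteResolution.of_splicedBy
    (splicedBySpliceComplex (K := fun m => (K m).X n) (L := fun m => (L.X m).X n)
      (fun m => (s.ι m).f n) (fun i j h => (s.π i j h).f n)
      (fun i j h => (s.isShortExact i j h).eval n))
    (fun m => (hB m).eval n) (fun m hm => projectiveComplexes.prop_X (hU m hm) n)
    (fun m hm => hC.prop_X (hV m hm) n) ((HomologicalComplex.eval _ _ n).mapIso e)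

open CochainComplex CochainComplex.HomComplex in
lemma IsDCProjectiveComplex.homComplex_acyclic (hX : IsDCProjectiveComplex C X)
    {H : CochainComplex (ModuleCat.{u} R) ℤ} (hH : cFlatComplexes C H) :
    (HomComplex X H).Acyclic := by
  obtain ⟨L, K, s, hB, hU, -, ⟨e⟩⟩ := hX.exists_splicedBy
  refine homComplex_acyclic_right_of_extension ((s.isShortExact 0 1 rfl).of_iso_right e.symm)
    (fun n z hz => ?_) (projectiveComplexes.homComplex_acyclic (hU 0 le_rfl) H)
  let c : Cocycle (K 0) H n := Cocycle.mk z (n + 1) rfl hz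
  -- As a morphism to `H⟦n⟧`, which is again `C`-flat, the cocycle extends.
  obtain ⟨g, hg⟩ := hB 0 _ (complexesWithCyclesIn_shift hH n) (Cocycle.equivHomShift.symm c)
  refine ⟨(Cocycle.equivHomShift g : Cocycle _ _ _), Cocycle.δ_eq_zero _ _, ?_⟩
  have h := Cocycle.equivHomShift_comp (s.ι 0) g
  rw [hg, AddEquiv.apply_symm_apply] at h
  exact (congrArg Subtype.val h).symm

/-- Complexes of modules in `extOrthogonal (cFlatModules C)` with `Hom(X, H)` exact for all `C`-flat
`H` have projective precovers with a kernel of the same kind. -/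
lemma exists_projective_step (hX : ∀ n, extOrthogonal (cFlatModules C) (X.X n))
    (hX' : ∀ H, cFlatComplexes C H → (CochainComplex.HomComplex X H).Acyclic) :
    ∃ (K P : CochainComplex (ModuleCat.{u} R) ℤ) (i : K ⟶ P) (p : P ⟶ X),
      ((∀ n, extOrthogonal (cFlatModules C) (K.X n)) ∧
        ∀ H, cFlatComplexes C H → (CochainComplex.HomComplex K H).Acyclic) ∧
      projectiveComplexes R P ∧ IsShortExact i p ∧ ExtendsAlong (cFlatComplexes C) i := by
  -- The summand `Qⁿ⁺¹` of the disk complex in degree `n` is the one that covers `Xⁿ`, hence the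
  -- shift.
  let Q : ℤ → ModuleCat.{u} R := fun n => Projective.over (X.X (n - 1))
  have hQ : ∀ n, projectiveModules R (Q n) := fun n =>
    ModuleCat.projective_of_module_projective (Projective.over (X.X (n - 1)))
  have hψ : ∀ m n : ℤ, m + 1 = n → ∃ f : Q n ⟶ X.X m, Epi f := by
    intro m n h
    obtain rfl : m = n - 1 := by lia
    exact ⟨Projective.π _, inferInstance⟩
  choose ψ hψ using hψ
  have hepi := diskComplex.epi_desc ψ hψ
  have hs := IsShortExact.kernel_ι (diskComplex.desc ψ)
  have hP : projectiveComplexes R (diskComplex Q) := diskComplex.complexesWithCyclesIn Q hQ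
  have hext : ∀ H, cFlatComplexes C H → ∀ (a b : ℤ) (f : (kernel (diskComplex.desc ψ)).X a ⟶ H.X b),
      ∃ g, (kernel.ι (diskComplex.desc ψ)).f a ≫ g = f := fun H hH a b f =>
    extOrthogonal.exists_extension_of_cycles (hs.eval a) (hX a) hH b f
  refine ⟨_, _, _, _, ⟨fun n => ?_, fun H hH => ?_⟩, hP, hs, fun H hH f => ?_⟩
  · exact .left (hs.eval n)
      (extOrthogonal_projectiveModules (projectiveComplexes.prop_X hP n)) (hX n)
  · exact homComplex_acyclic_left hs (hext H hH) (diskComplex.homComplex_acyclic Q H) (hX' H hH)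
  · exact exists_hom_extension hs (hext H hH) (hX' H hH) f

lemma exists_cProjective_step (hC : IsSemidualizing C)
    (hX : ∀ n, coresolved (cProjectiveModules C) (cFlatModules C) (X.X n))
    (hX' : ∀ H, cFlatComplexes C H → (CochainComplex.HomComplex X H).Acyclic) :
    ∃ (V Y : CochainComplex (ModuleCat.{u} R) ℤ) (i : X ⟶ V) (p : V ⟶ Y),
      cProjectiveComplexes C V ∧
      ((∀ n, coresolved (cProjectiveModules C) (cFlatModules C) (Y.X n)) ∧
        ∀ H, cFlatComplexes C H → (CochainComplex.HomComplex Y H).Acyclic) ∧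
      IsShortExact i p ∧ ExtendsAlong (cFlatComplexes C) i := by
  choose Q N φ q hQ hN hφ using fun n => (hX n).exists_step
  have hmono := diskComplex.mono_lift φ fun n => (hφ n).mono
  have hs := IsShortExact.cokernel_π (diskComplex.lift φ)
  -- In degree `n` the embedding is `(φⁿ, φⁿ⁺¹ ∘ d)`; its second component does not affect the
  -- cokernel up to isomorphism, since it extends along `φⁿ`.
  have hY : ∀ n, coresolved (cProjectiveModules C) (cFlatModules C)
      ((cokernel (diskComplex.lift φ)).X n) := fun n =>
    coresolved.of_prod cProjectiveModules_prod (hφ n) (hN n) (hQ (n + 1))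
      (hC.extOrthogonal_of_cProjective (hQ (n + 1)))
      (cFlatModules_of_cProjectiveModules (hQ (n + 1))) _ (hs.eval n) (fun _ => rfl)
  have hext : ∀ H, cFlatComplexes C H → ∀ (a b : ℤ) (f : X.X a ⟶ H.X b),
      ∃ g, (diskComplex.lift φ).f a ≫ g = f := fun H hH a b f =>
    extOrthogonal.exists_extension_of_cycles (hs.eval a) (hY a).mem_extOrthogonal hH b f
  have hY' : ∀ H, cFlatComplexes C H →
      (CochainComplex.HomComplex (cokernel (diskComplex.lift φ)) H).Acyclic := fun H hH =>
    homComplex_acyclic_right hs (hext H hH) (hX' H hH) (diskComplex.homComplex_acyclic Q H)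
  exact ⟨_, _, _, _, diskComplex.complexesWithCyclesIn Q hQ, ⟨hY, hY'⟩, hs,
    fun H hH f => exists_hom_extension hs (hext H hH) (hY' H hH) f⟩

end DCProjective

theorem theorem2p8 {R : Type u} [CommRing R] (C : ModuleCat.{u} R) (hC : IsSemidualizing C)
    (X : CochainComplex (ModuleCat.{u} R) ℤ) :
    IsDCProjectiveComplex C X ↔
      (∀ i : ℤ, IsDCProjectiveModule C (X.X i)) ∧
      (∀ H : CochainComplex (ModuleCat.{u} R) ℤ, cFlatComplexes C H →
        (CochainComplex.HomComplex X H).Acyclic) := by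
  refine ⟨fun hX => ⟨hX.isDCProjectiveModule hC, fun H hH => hX.homComplex_acyclic hH⟩, ?_⟩
  rintro ⟨hX, hX'⟩
  have hX₁ : ∀ n, coresolved (cProjectiveModules C) (cFlatModules C) (X.X n) := fun n =>
    .of_isImageInCompleteResolution (fun U hU => by
      have : Module.Projective R U := hU
      infer_instance) (fun V hV => hC.extOrthogonal_of_cProjective hV) (hX n)
  -- Going left, only Ext-orthogonality of the terms persists; going right, the terms must stay
  -- coresolved. Exactness of `Hom(-, H)` is carried along both ways.
  exact IsImageInCompleteResolution.of_steps
    (fun Y hY => exists_projective_step hY.1 hY.2)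
    (fun Y hY => exists_cProjective_step hC hY.1 hY.2)
    ⟨hX₁, hX'⟩ ⟨fun n => (hX₁ n).mem_extOrthogonal, hX'⟩
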